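/- Let $d \ge 3$, and let $\Gamma$ be a group with a finite symmetric generating set $\mathcal S$, $|\mathcal S| = d$, whose Cayley graph (with an edge between $x$ and $y$ if and only if $yx^{-1} \in \mathcal S$) is the $d$-regular tree. Let $p \in [0,1)$. The elephant random walk with memory parameter $p$ is the process $w_0 = e$, $w_n = g_n \cdots g_1$, whose steps are chosen as follows: $g_1$ is uniform on $\mathcal S$; for $n \ge 1$, given $g_1, \dots, g_n$, an index $D$ is chosen uniformly from $\{1,\dots,n\}$, and then $g_{n+1} = g_D$ with probability $p$, while $g_{n+1} = a$ with probability $\frac{1-p}{d-1}$ for each $a \in \mathcal S \setminus \{g_D\}$. Let $\Delta_n$ be the distance of $w_n$ from $e$ in the Cayley graph (the word metric). Then $$\lim_{n \to \infty} \frac{\Delta_n}{n} = \frac{d-2}{d} \quad \text{almost surely.}$$ The same holds for the simple random walk, whose steps $g_1, g_2, \dots$ are independent and uniform on $\mathcal S$. So the speed of the elephant random walk does not depend on $p$ and equals the speed of the simple random walk. -/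

import Mathlib

open MeasureTheory ProbabilityTheory Filter Topology

/-- The left Cayley graph of `Γ` with respect to `S`: distinct `x` and `y` are joined by an edge
iff `y * x⁻¹ ∈ S` (or `x * y⁻¹ ∈ S`, which is the same for a symmetric set `S`). -/
def leftCayleyGraph {Γ : Type*} [Group Γ] (S : Finset Γ) : SimpleGraph Γ :=
  SimpleGraph.fromRel (fun x y => y * x⁻¹ ∈ S)

/-- `G` is the `d`-regular tree: a tree all of whose vertices have degree `d`
(to be used with `d > 0`, so that the `ncard` below is a true cardinality). -/
structure IsRegularTree {V : Type*} (G : SimpleGraph V) (d : ℕ) : Prop where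
  isTree : G.IsTree
  regular : ∀ v, (G.neighborSet v).ncard = d

/-- The position `w n = g n * ⋯ * g 1` of the left walk with steps `g 1, g 2, …`, started at the
identity. The value `g 0` is not used. -/
def walkPosition {Γ : Type*} [Group Γ] (g : ℕ → Γ) : ℕ → Γ
  | 0 => 1
  | n + 1 => g (n + 1) * walkPosition g n

/-- The distance from the identity after `n` steps, in the word metric of `S`, that is, the graph
metric of the Cayley graph. -/
noncomputable def walkDistance {Γ : Type*} [Group Γ] (S : Finset Γ) (g : ℕ → Γ) (n : ℕ) : ℕ :=
  (leftCayleyGraph S).dist (walkPosition g n) 1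

/-- The event that the first `n` steps `g 1, …, g n` are `s 1, …, s n`. -/
def pastEvent {Ω Γ : Type*} (g : ℕ → Ω → Γ) (n : ℕ) (s : ℕ → Γ) : Set Ω :=
  {ω | ∀ i ∈ Finset.Icc 1 n, g i ω = s i}

open Classical in
/-- `g 1, g 2, …` are the steps of an elephant random walk with memory parameter `p` and step set
`S`; `D n` is the past epoch in `{1, …, n}` that is recalled for the choice of `g (n + 1)`.
The prescribed conditional probabilities `P(B ∣ A) = q` are written `P(A ∩ B) = q * P(A)`. -/
structure IsElephantRandomWalk {Ω Γ : Type*} [MeasurableSpace Ω] [MeasurableSpace Γ]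
    (P : Measure Ω) (S : Finset Γ) (p : ℝ) (D : ℕ → Ω → ℕ) (g : ℕ → Ω → Γ) : Prop where
  measurable_step : ∀ n, Measurable (g n)
  measurable_epoch : ∀ n, Measurable (D n)
  /-- The first step is uniform on `S`. -/
  first_step : ∀ a ∈ S, P.real {ω | g 1 ω = a} = 1 / (S.card : ℝ)
  /-- Given the steps `g 1, …, g n`, the epoch `D n` is uniform on `{1, …, n}`. -/
  epoch_uniform : ∀ n, 1 ≤ n → ∀ s : ℕ → Γ, ∀ k ∈ Finset.Icc 1 n,
    P.real (pastEvent g n s ∩ {ω | D n ω = k}) = 1 / (n : ℝ) * P.real (pastEvent g n s)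
  /-- Given the steps `g 1, …, g n` and `D n = k`, the next step is `g k` with probability `p`,
  and it is each other element of `S` with probability `(1 - p) / (|S| - 1)`. -/
  next_step : ∀ n, 1 ≤ n → ∀ s : ℕ → Γ, ∀ k ∈ Finset.Icc 1 n, ∀ a ∈ S,
    P.real (pastEvent g n s ∩ {ω | D n ω = k} ∩ {ω | g (n + 1) ω = a}) =
      (if a = s k then p else (1 - p) / ((S.card : ℝ) - 1)) *
        P.real (pastEvent g n s ∩ {ω | D n ω = k})

/-- `g 1, g 2, …` are the steps of the simple random walk with step set `S`: they are independent
and uniform on `S`. -/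
structure IsSimpleRandomWalk {Ω Γ : Type*} [MeasurableSpace Ω] [MeasurableSpace Γ]
    (P : Measure Ω) (S : Finset Γ) (g : ℕ → Ω → Γ) : Prop where
  measurable_step : ∀ n, Measurable (g n)
  independent : iIndepFun (fun n => g (n + 1)) P
  uniform : ∀ n, ∀ a ∈ S, P.real {ω | g (n + 1) ω = a} = 1 / (S.card : ℝ)

/-!
Both walks are instances of one scheme: given the first `n` steps, the next step is the letter `a`
with probability `1 / d + α * (x - 1 / d)`, where `x` is the frequency of `a` so far. For the
elephant random walk `α = p - (1 - p) / (d - 1)`, for the simple random walk `α = 0`; in either case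
`|α| < 1` (`IsLinearlyReinforced`).

The indicator that step `n + 1` is `a`, minus its conditional probability, is a bounded martingale
difference, also when multiplied by a bounded function of the past. Such differences are orthogonal,
so the second moment of the sum of the first `n` of them is of order `n`, and their averages tend to
zero almost surely (`IsLinearlyReinforced.ae_tendsto_sum_innovation_div`). Conditioning on the past
is done by hand: steps almost surely lie in the finite set `S`, so a function of `n` steps is a
finite combination of indicators of cylinder events.

This is used twice. With weight `1`, the deviation `e n` of the frequency of `a` from `1 / d` equals
a null sequence plus `α` times the Cesàro mean of `e`, which forces `e n → 0` as `|α| < 1`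
(`tendsto_zero_of_eq_add_mul_mean`): all letters become equally frequent, and all conditional
probabilities tend to `1 / d`. With the weight that indicates that `a` leads towards the identity,
it turns the number of backward steps into the sum of their conditional probabilities. From a vertex
other than the identity, exactly one letter leads backward, as the Cayley graph is a tree. So
`Δ_n / n = 1 - (2 / d) * A_n / n + o(1)`, where `A_n ≤ n` counts the times spent away from the
identity (`tendsto_walkDistance_div`). As `2 / d < 1`, the distance is eventually positive, hence
`A_n / n → 1` and the speed is `1 - 2 / d`.
-/

/-! ### Averages and feedback recursions -/

/-- An eventual bound on the terms of a sequence passes to its Cesàro means, up to any loss. -/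
theorem eventually_abs_sum_range_div_le {e : ℕ → ℝ} {B δ : ℝ} (hδ : 0 < δ)
    (h : ∀ᶠ n in atTop, |e n| ≤ B) :
    ∀ᶠ n : ℕ in atTop, |(∑ k ∈ Finset.range n, e k) / n| ≤ B + δ := by
  obtain ⟨N, hN⟩ := eventually_atTop.1 h
  have hlim := (tendsto_const_div_atTop_nhds_zero_nat
    (∑ k ∈ Finset.range N, |e k|)).eventually (gt_mem_nhds hδ)
  filter_upwards [hlim, eventually_ge_atTop N, eventually_gt_atTop 0] with n hn hNn hn0
  have hn0' : (0 : ℝ) < n := by exact_mod_cast hn0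
  have hB : 0 ≤ B := (abs_nonneg _).trans (hN N le_rfl)
  have hsum : ∑ k ∈ Finset.range n, |e k| ≤ ∑ k ∈ Finset.range N, |e k| + n * B := by
    rw [← Finset.sum_range_add_sum_Ico _ hNn]
    have h1 : ∑ k ∈ Finset.Ico N n, |e k| ≤ ∑ _k ∈ Finset.Ico N n, B :=
      Finset.sum_le_sum fun k hk => hN k (Finset.mem_Ico.1 hk).1
    have h2 : ((n - N : ℕ) : ℝ) * B ≤ n * B := by
      gcongr
      exact Nat.sub_le n N
    simp only [Finset.sum_const, Nat.card_Ico, nsmul_eq_mul] at h1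
    linarith
  rw [abs_div, Nat.abs_cast, div_le_iff₀ hn0']
  rw [div_lt_iff₀ hn0'] at hn
  have := Finset.abs_sum_le_sum_abs e (Finset.range n)
  nlinarith

/-- A bounded sequence that is, up to a null sequence, `α` times its own Cesàro mean with `|α| < 1`
tends to zero: Cesàro means do not increase `limsup |e n|`, whereas the factor `α` decreases it. -/
theorem tendsto_zero_of_eq_add_mul_mean {e t : ℕ → ℝ} {α B : ℝ} (hα : |α| < 1)
    (hB : ∀ n, |e n| ≤ B) (ht : Tendsto t atTop (𝓝 0))
    (he : ∀ᶠ n : ℕ in atTop, e n = t n + α * ((∑ k ∈ Finset.range n, e k) / n)) :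
    Tendsto e atTop (𝓝 0) := by
  have hcontr : ∀ C : ℝ, 0 < C → (∀ᶠ n in atTop, |e n| ≤ C) →
      ∀ᶠ n in atTop, |e n| ≤ (1 + |α|) / 2 * C := by
    intro C hC h
    have hδ : 0 < (1 - |α|) / 4 * C := by
      have : 0 < 1 - |α| := by linarith
      positivity
    have ht' : ∀ᶠ n in atTop, |t n| < (1 - |α|) / 4 * C := by
      simpa using (ht.abs).eventually (gt_mem_nhds (by simpa using hδ))
    filter_upwards [eventually_abs_sum_range_div_le hδ h, ht', he] with n h1 h2 h3
    rw [h3]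
    have h4 := abs_add_le (t n) (α * ((∑ k ∈ Finset.range n, e k) / n))
    rw [abs_mul] at h4
    have h5 := mul_le_mul_of_nonneg_left h1 (abs_nonneg α)
    nlinarith [mul_nonneg (abs_nonneg α) hδ.le, mul_lt_mul_of_pos_right hα hδ]
  have hr0 : 0 ≤ (1 + |α|) / 2 := by positivity
  have hr1 : (1 + |α|) / 2 < 1 := by linarith
  have hrpos : 0 < (1 + |α|) / 2 := by positivity
  have hB1 : 0 < |B| + 1 := by positivity
  have hiter : ∀ m : ℕ, ∀ᶠ n in atTop, |e n| ≤ ((1 + |α|) / 2) ^ m * (|B| + 1) := by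
    intro m
    induction m with
    | zero => exact Eventually.of_forall fun n => by linarith [hB n, le_abs_self B]
    | succ m ih =>
      have := hcontr _ (by positivity) ih
      simpa only [pow_succ', mul_assoc] using this
  rw [Metric.tendsto_atTop']
  intro ε hε
  have hpow : Tendsto (fun m : ℕ => ((1 + |α|) / 2) ^ m * (|B| + 1)) atTop (𝓝 0) := by
    simpa using (tendsto_pow_atTop_nhds_zero_of_lt_one hr0 hr1).mul_const (|B| + 1)
  obtain ⟨m, hm⟩ := (hpow.eventually (gt_mem_nhds hε)).exists
  obtain ⟨N, hN⟩ := eventually_atTop.1 (hiter m)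
  exact ⟨N, fun n hn => by simpa using (hN n hn.le).trans_lt hm⟩

/-! ### Distances in the tree -/

/-- In a tree, every vertex other than the root has exactly one neighbour nearer to the root. -/
theorem SimpleGraph.IsTree.existsUnique_adj_dist_lt {V : Type*} {G : SimpleGraph V} (hG : G.IsTree)
    {x r : V} (hx : x ≠ r) : ∃! y, G.Adj x y ∧ G.dist y r < G.dist x r := by
  obtain ⟨p, hp⟩ := hG.connected.exists_walk_length_eq_dist x r
  cases p with
  | nil => exact absurd rfl hx
  | @cons _ y _ hxy q =>
    have hy : G.dist y r < G.dist x r := by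
      rw [← hp, SimpleGraph.Walk.length_cons]
      exact Nat.lt_succ_of_le (SimpleGraph.dist_le q)
    -- A shortest path from a nearer neighbour, extended by `x`, is the path from `x` to `r`.
    have key : ∀ z, G.Adj x z → G.dist z r < G.dist x r →
        ∃ w : G.Walk z r, ∃ h : G.Adj x z, (SimpleGraph.Walk.cons h w).IsPath := by
      intro z hxz hz
      obtain ⟨w, hw⟩ := hG.connected.exists_walk_length_eq_dist z r
      refine ⟨w, hxz, SimpleGraph.Walk.isPath_of_length_eq_dist _ ?_⟩
      have := hG.dist_eq_dist_add_one_of_adj r hxz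
      rw [SimpleGraph.dist_comm, SimpleGraph.dist_comm (u := r) (v := z)] at this
      rw [SimpleGraph.Walk.length_cons, hw]
      omega
    refine ⟨y, ⟨hxy, hy⟩, ?_⟩
    rintro z ⟨hxz, hz⟩
    obtain ⟨w₁, h₁, hp₁⟩ := key y hxy hy
    obtain ⟨w₂, h₂, hp₂⟩ := key z hxz hz
    have heq := congrArg SimpleGraph.Walk.snd
      ((hG.existsUnique_path x r).unique hp₁ hp₂)
    simpa using heq.symm

section Cayley

variable {Γ : Type*} [Group Γ] {S : Finset Γ}

theorem leftCayleyGraph_adj_iff (hsymm : ∀ s ∈ S, s⁻¹ ∈ S) {x y : Γ} :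
    (leftCayleyGraph S).Adj x y ↔ x ≠ y ∧ y * x⁻¹ ∈ S := by
  rw [leftCayleyGraph, SimpleGraph.fromRel_adj]
  refine and_congr_right fun _ => ⟨?_, Or.inl⟩
  rintro (h | h)
  · exact h
  · simpa using hsymm _ h

/-- The identity is not a generator, for it would contribute no edge and the degree would be
less than `|S|`. -/
theorem one_notMem_of_isRegularTree (hsymm : ∀ s ∈ S, s⁻¹ ∈ S)
    (htree : IsRegularTree (leftCayleyGraph S) S.card) : (1 : Γ) ∉ S := by
  classical
  intro h1
  have hsub : (leftCayleyGraph S).neighborSet 1 ⊆ (S.erase 1 : Finset Γ) := by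
    intro y hy
    have := (leftCayleyGraph_adj_iff hsymm).1 hy
    simpa [eq_comm, and_comm] using this
  have hle := Set.ncard_le_ncard hsub (Finset.finite_toSet _)
  rw [htree.regular, Set.ncard_coe_finset] at hle
  exact absurd hle (Finset.card_erase_lt_of_mem h1).not_ge

theorem leftCayleyGraph_adj_mul (hsymm : ∀ s ∈ S, s⁻¹ ∈ S)
    (htree : IsRegularTree (leftCayleyGraph S) S.card) {a : Γ} (ha : a ∈ S) (x : Γ) :
    (leftCayleyGraph S).Adj x (a * x) := by
  refine (leftCayleyGraph_adj_iff hsymm).2 ⟨fun h => ?_, by simpa using ha⟩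
  have ha1 : a = 1 := by simpa using h.symm
  exact one_notMem_of_isRegularTree hsymm htree (ha1 ▸ ha)

open Classical in
/-- The indicator that the generator `a` leads from `x` towards the identity. -/
noncomputable def backward (S : Finset Γ) (x a : Γ) : ℝ :=
  if (leftCayleyGraph S).dist (a * x) 1 < (leftCayleyGraph S).dist x 1 then 1 else 0

theorem abs_backward_le_one (x a : Γ) : |backward S x a| ≤ 1 := by
  unfold backward
  split_ifs <;> simp

theorem sum_backward_one : ∑ a ∈ S, backward S 1 a = 0 := by
  simp [backward]

theorem sum_backward_of_ne_one (hsymm : ∀ s ∈ S, s⁻¹ ∈ S)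
    (htree : IsRegularTree (leftCayleyGraph S) S.card) {x : Γ} (hx : x ≠ 1) :
    ∑ a ∈ S, backward S x a = 1 := by
  obtain ⟨y, ⟨hxy, hlt⟩, huniq⟩ := htree.isTree.existsUnique_adj_dist_lt hx
  have hmem : y * x⁻¹ ∈ S := ((leftCayleyGraph_adj_iff hsymm).1 hxy).2
  rw [Finset.sum_eq_single_of_mem _ hmem]
  · simp [backward, hlt]
  · intro b hb hne
    refine if_neg fun hlt' => hne ?_
    rw [← huniq (b * x) ⟨leftCayleyGraph_adj_mul hsymm htree hb x, hlt'⟩]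
    simp

theorem dist_mul_one (hsymm : ∀ s ∈ S, s⁻¹ ∈ S)
    (htree : IsRegularTree (leftCayleyGraph S) S.card) {a : Γ} (ha : a ∈ S) (x : Γ) :
    ((leftCayleyGraph S).dist (a * x) 1 : ℝ) =
      (leftCayleyGraph S).dist x 1 + (1 - 2 * backward S x a) := by
  have h := htree.isTree.dist_eq_dist_add_one_of_adj 1 (leftCayleyGraph_adj_mul hsymm htree ha x)
  rw [SimpleGraph.dist_comm, SimpleGraph.dist_comm (v := a * x)] at h
  unfold backward
  rcases h with h | h
  · rw [if_pos (by omega), h]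
    push_cast
    ring
  · rw [if_neg (by omega), h]
    push_cast
    ring

open Classical in
theorem walkDistance_eq_sum (hsymm : ∀ s ∈ S, s⁻¹ ∈ S)
    (htree : IsRegularTree (leftCayleyGraph S) S.card) {s : ℕ → Γ} (hs : ∀ n, s (n + 1) ∈ S)
    (n : ℕ) :
    (walkDistance S s n : ℝ) = ∑ k ∈ Finset.range n,
      (1 - 2 * ∑ a ∈ S, backward S (walkPosition s k) a * if s (k + 1) = a then 1 else 0) := by
  induction n with
  | zero => simp [walkDistance, walkPosition]
  | succ n ih =>
    rw [Finset.sum_range_succ, ← ih]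
    simp only [mul_ite, mul_one, mul_zero, Finset.sum_ite_eq, hs n, if_true]
    exact dist_mul_one hsymm htree (hs n) _

end Cayley

/-! ### Linearly reinforced step sequences -/

section Reinforced

variable {Γ : Type*} {S : Finset Γ}

open Classical in
/-- The number of steps among `s 1, …, s n` that are equal to `a`, minus its value `n / |S|` for
equidistributed steps. -/
noncomputable def excess (S : Finset Γ) (s : ℕ → Γ) (a : Γ) (n : ℕ) : ℝ :=
  ∑ i ∈ Finset.Icc 1 n, ((if s i = a then (1 : ℝ) else 0) - 1 / S.card)

/-- The conditional probability that step `n + 1` is `a`, given the steps `s 1, …, s n`, for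
reinforcement of strength `α`. For `n = 0` the junk value `0 / 0 = 0` gives the uniform
probability `1 / |S|`, as it should be. -/
noncomputable def stepProb (S : Finset Γ) (α : ℝ) (a : Γ) (s : ℕ → Γ) (n : ℕ) : ℝ :=
  1 / S.card + α * (excess S s a n / n)

open Classical in
/-- The indicator that step `n + 1` is `a`, minus the conditional probability of this event given
the steps before: a martingale difference. -/
noncomputable def innovation (S : Finset Γ) (α : ℝ) (a : Γ) (s : ℕ → Γ) (n : ℕ) : ℝ :=
  (if s (n + 1) = a then 1 else 0) - stepProb S α a s n

open Classical in
theorem excess_succ (s : ℕ → Γ) (a : Γ) (n : ℕ) :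
    excess S s a (n + 1) =
      excess S s a n + ((if s (n + 1) = a then 1 else 0) - 1 / (S.card : ℝ)) :=
  Finset.sum_Icc_succ_top (Nat.le_add_left 1 n) _

theorem abs_excess_le (hS : 0 < S.card) (s : ℕ → Γ) (a : Γ) (n : ℕ) : |excess S s a n| ≤ n := by
  have hc : (1 : ℝ) ≤ S.card := by exact_mod_cast hS
  have h1 : 1 / (S.card : ℝ) ≤ 1 := (div_le_one (by linarith)).2 hc
  have h0 : 0 ≤ 1 / (S.card : ℝ) := by positivity
  refine (Finset.abs_sum_le_sum_abs _ _).trans ?_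
  refine (Finset.sum_le_card_nsmul _ _ 1 fun i _ => ?_).trans (by simp)
  rw [abs_le]
  split_ifs <;> constructor <;> linarith

theorem abs_excess_div_le_one (hS : 0 < S.card) (s : ℕ → Γ) (a : Γ) (n : ℕ) :
    |excess S s a n / n| ≤ 1 := by
  rw [abs_div, Nat.abs_cast]
  exact div_le_one_of_le₀ (abs_excess_le hS s a n) (Nat.cast_nonneg n)

theorem abs_innovation_le {α : ℝ} (hS : 0 < S.card) (hα : |α| < 1) (s : ℕ → Γ) (a : Γ) (n : ℕ) :
    |innovation S α a s n| ≤ 3 := by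
  have hc : (1 : ℝ) ≤ S.card := by exact_mod_cast hS
  have h1 : 1 / (S.card : ℝ) ≤ 1 := (div_le_one (by linarith)).2 hc
  have h0 : 0 ≤ 1 / (S.card : ℝ) := by positivity
  have h2 : |α * (excess S s a n / n)| ≤ 1 := by
    rw [abs_mul]
    exact mul_le_one₀ hα.le (abs_nonneg _) (abs_excess_div_le_one hS s a n)
  rw [abs_le] at h2 ⊢
  unfold innovation stepProb
  split_ifs <;> constructor <;> linarith

theorem excess_eq_sum_innovation (α : ℝ) (s : ℕ → Γ) (a : Γ) (n : ℕ) :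
    excess S s a n = ∑ k ∈ Finset.range n, innovation S α a s k +
      α * ∑ k ∈ Finset.range n, excess S s a k / k := by
  induction n with
  | zero => simp [excess]
  | succ n ih =>
    rw [excess_succ, ih, Finset.sum_range_succ, Finset.sum_range_succ, innovation, stepProb]
    ring

theorem tendsto_excess_div {α : ℝ} (hS : 0 < S.card) (hα : |α| < 1) {s : ℕ → Γ} {a : Γ}
    (h : Tendsto (fun n : ℕ => (∑ k ∈ Finset.range n, innovation S α a s k) / n) atTop (𝓝 0)) :
    Tendsto (fun n : ℕ => excess S s a n / n) atTop (𝓝 0) := by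
  refine tendsto_zero_of_eq_add_mul_mean hα (abs_excess_div_le_one hS s a) h
    (Eventually.of_forall fun n => ?_)
  rw [excess_eq_sum_innovation α s a n, add_div, mul_div_assoc]

theorem sum_excess (hS : 0 < S.card) {s : ℕ → Γ} {n : ℕ} (hs : ∀ i ∈ Finset.Icc 1 n, s i ∈ S) :
    ∑ a ∈ S, excess S s a n = 0 := by
  classical
  unfold excess
  rw [Finset.sum_comm]
  refine Finset.sum_eq_zero fun i hi => ?_
  have : (S.card : ℝ) ≠ 0 := by exact_mod_cast hS.ne'
  simp only [Finset.sum_sub_distrib, Finset.sum_ite_eq, hs i hi, if_true, Finset.sum_const,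
    nsmul_eq_mul, mul_one_div_cancel this, sub_self]

theorem sum_stepProb (hS : 0 < S.card) (α : ℝ) {s : ℕ → Γ} {n : ℕ}
    (hs : ∀ i ∈ Finset.Icc 1 n, s i ∈ S) : ∑ a ∈ S, stepProb S α a s n = 1 := by
  have : (S.card : ℝ) ≠ 0 := by exact_mod_cast hS.ne'
  simp only [stepProb, Finset.sum_add_distrib, ← Finset.mul_sum, ← Finset.sum_div,
    sum_excess hS hs]
  simp [this]

theorem dependsOn_stepProb (S : Finset Γ) (α : ℝ) (a : Γ) (n : ℕ) :
    DependsOn (fun s => stepProb S α a s n) (Set.Icc 1 n) := by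
  intro s t h
  have : excess S s a n = excess S t a n :=
    Finset.sum_congr rfl fun i hi => by rw [h i (Finset.mem_Icc.1 hi)]
  simp only [stepProb, this]

theorem dependsOn_innovation (S : Finset Γ) (α : ℝ) (a : Γ) (n : ℕ) :
    DependsOn (fun s => innovation S α a s n) (Set.Icc 1 (n + 1)) := by
  intro s t h
  have h1 := dependsOn_stepProb S α a n fun i hi => h i ⟨hi.1, hi.2.trans n.le_succ⟩
  dsimp only at h1 ⊢
  rw [innovation, innovation, h1, h (n + 1) ⟨Nat.le_add_left 1 n, le_rfl⟩]

end Reinforced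

/-- The speed along a single trajectory: it suffices that the innovations of each letter `a`, both
plain and restricted to the times at which `a` leads towards the identity, average to zero. -/
theorem tendsto_walkDistance_div {Γ : Type*} [Group Γ] {S : Finset Γ} {α : ℝ} (hd : 3 ≤ S.card)
    (hsymm : ∀ s ∈ S, s⁻¹ ∈ S) (htree : IsRegularTree (leftCayleyGraph S) S.card)
    (hα : |α| < 1) {s : ℕ → Γ} (hs : ∀ n, s (n + 1) ∈ S)
    (hfreq : ∀ a ∈ S, Tendsto (fun n : ℕ =>
      (∑ k ∈ Finset.range n, innovation S α a s k) / n) atTop (𝓝 0))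
    (hback : ∀ a ∈ S, Tendsto (fun n : ℕ => (∑ k ∈ Finset.range n,
      backward S (walkPosition s k) a * innovation S α a s k) / n) atTop (𝓝 0)) :
    Tendsto (fun n : ℕ => (walkDistance S s n : ℝ) / n) atTop
      (𝓝 (((S.card : ℝ) - 2) / S.card)) := by
  have hS : 0 < S.card := by omega
  have hd' : (3 : ℝ) ≤ S.card := by exact_mod_cast hd
  -- `b k` indicates that the walk is away from the identity at time `k`.
  set b : ℕ → ℝ := fun k => ∑ a ∈ S, backward S (walkPosition s k) a with hb
  have hb_le : ∀ k, b k ≤ 1 := by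
    intro k
    by_cases h : walkPosition s k = 1
    · simp [hb, h, sum_backward_one]
    · exact (sum_backward_of_ne_one hsymm htree h).le
  set r : ℕ → ℝ := fun n =>
    ∑ a ∈ S, (∑ k ∈ Finset.range n, backward S (walkPosition s k) a * innovation S α a s k) / n +
    ∑ a ∈ S, (∑ k ∈ Finset.range n,
      backward S (walkPosition s k) a * (α * (excess S s a k / k))) / n with hr
  have hr0 : Tendsto r atTop (𝓝 0) := by
    have h1 := tendsto_finsetSum S hback
    have h2 : Tendsto (fun n : ℕ => ∑ a ∈ S, (∑ k ∈ Finset.range n,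
        backward S (walkPosition s k) a * (α * (excess S s a k / k))) / n) atTop
        (𝓝 (∑ _a ∈ S, (0 : ℝ))) := by
      refine tendsto_finsetSum S fun a ha => ?_
      have h3 : Tendsto (fun k : ℕ => backward S (walkPosition s k) a *
          (α * (excess S s a k / k))) atTop (𝓝 0) := by
        have h4 := (tendsto_excess_div hS hα (hfreq a ha)).const_mul α
        rw [mul_zero] at h4
        refine squeeze_zero_norm (fun k => ?_) (tendsto_zero_iff_norm_tendsto_zero.1 h4)
        rw [norm_mul]
        exact mul_le_of_le_one_left (norm_nonneg _) (abs_backward_le_one _ _)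
      simpa only [div_eq_inv_mul] using h3.cesaro
    simpa using h1.add h2
  have hform : ∀ n : ℕ, 0 < n → (walkDistance S s n : ℝ) / n =
      1 - 2 / S.card * ((n : ℝ)⁻¹ * ∑ k ∈ Finset.range n, b k) - 2 * r n := by
    intro n hn
    have hn' : (n : ℝ) ≠ 0 := by exact_mod_cast hn.ne'
    have hterm : ∀ k, (1 - 2 * ∑ a ∈ S, backward S (walkPosition s k) a *
        (open Classical in if s (k + 1) = a then (1 : ℝ) else 0)) =
        1 - 2 / S.card * b k
          - 2 * (∑ a ∈ S, backward S (walkPosition s k) a * innovation S α a s k)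
          - 2 * (∑ a ∈ S, backward S (walkPosition s k) a * (α * (excess S s a k / k))) := by
      intro k
      simp only [hb, innovation, stepProb, Finset.mul_sum, sub_sub,
        ← Finset.sum_add_distrib]
      congr 1
      exact Finset.sum_congr rfl fun a _ => by ring
    rw [walkDistance_eq_sum hsymm htree hs, Finset.sum_congr rfl fun k _ => hterm k]
    simp only [Finset.sum_sub_distrib, ← Finset.mul_sum, hr, ← Finset.sum_div]
    rw [Finset.sum_comm (s := S), Finset.sum_comm (s := S)]
    generalize (∑ k ∈ Finset.range n, ∑ a ∈ S,
      backward S (walkPosition s k) a * innovation S α a s k) = X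
    generalize (∑ k ∈ Finset.range n, ∑ a ∈ S,
      backward S (walkPosition s k) a * (α * (excess S s a k / k))) = Y
    simp only [Finset.sum_const, Finset.card_range, nsmul_eq_mul, mul_one]
    field_simp
    ring
  -- The walk is transient, as `b k ≤ 1` already gives a positive lower speed.
  have hne : ∀ᶠ n in atTop, walkPosition s n ≠ 1 := by
    filter_upwards [hr0.eventually (gt_mem_nhds (show (0 : ℝ) < 1 / 6 by norm_num)),
      eventually_gt_atTop 0] with n hrn hn hw
    have hn' : (0 : ℝ) < n := by exact_mod_cast hn
    have h0 := hform n hn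
    have hmean : (n : ℝ)⁻¹ * ∑ k ∈ Finset.range n, b k ≤ 1 := by
      rw [inv_mul_le_iff₀ hn', mul_one]
      exact (Finset.sum_le_card_nsmul _ _ 1 fun k _ => hb_le k).trans (by simp)
    have h2 : 2 / (S.card : ℝ) ≤ 2 / 3 := by gcongr
    have h3 : 0 ≤ 2 / (S.card : ℝ) := by positivity
    have h4 := mul_le_mul_of_nonneg_left hmean h3
    simp only [walkDistance, hw, SimpleGraph.dist_self, Nat.cast_zero, zero_div] at h0
    linarith
  have hb1 : Tendsto b atTop (𝓝 1) :=
    tendsto_const_nhds.congr' (hne.mono fun n hn => (sum_backward_of_ne_one hsymm htree hn).symm)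
  have hlim := ((hb1.cesaro.const_mul (2 / (S.card : ℝ))).const_sub 1).sub (hr0.const_mul 2)
  have hval : 1 - 2 / (S.card : ℝ) * 1 - 2 * 0 = ((S.card : ℝ) - 2) / S.card := by
    field_simp
    ring
  rw [hval] at hlim
  refine hlim.congr' ?_
  filter_upwards [eventually_gt_atTop 0] with n hn
  exact (hform n hn).symm

/-! ### A strong law from second moments -/

/-- Second moments of order `n` and bounded steps force `T n / n → 0`: the second moments of
`T (n ^ 2) / n ^ 2` are summable, and bounded steps interpolate between consecutive squares. -/
theorem ae_tendsto_div_of_integral_sq_le {Ω : Type*} [MeasurableSpace Ω] {P : Measure Ω}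
    {T : ℕ → Ω → ℝ} {C B : ℝ} (hint : ∀ n, Integrable (fun ω => T n ω ^ 2) P)
    (hstep : ∀ n ω, |T (n + 1) ω - T n ω| ≤ B) (hsq : ∀ n : ℕ, ∫ ω, T n ω ^ 2 ∂P ≤ C * n) :
    ∀ᵐ ω ∂P, Tendsto (fun n : ℕ => T n ω / n) atTop (𝓝 0) := by
  set F : ℕ → Ω → ℝ := fun k ω => (T (k ^ 2) ω / (k ^ 2 : ℕ)) ^ 2 with hF
  have hFint : ∀ k, Integrable (F k) P := by
    intro k
    simp only [hF, div_pow]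
    exact (hint _).div_const _
  have hFle : ∀ k, ∫ ω, F k ω ∂P ≤ C * (1 / (k : ℝ) ^ 2) := by
    intro k
    simp only [hF, div_pow]
    rw [integral_div]
    rcases Nat.eq_zero_or_pos k with rfl | hk
    · simp
    · have hk' : (0 : ℝ) < k := by exact_mod_cast hk
      rw [div_le_iff₀ (by positivity)]
      refine (hsq _).trans_eq ?_
      push_cast
      field_simp
  have hsum : Summable fun k => ∫ ω, F k ω ∂P :=
    Summable.of_nonneg_of_le (fun k => integral_nonneg fun ω => sq_nonneg _) hFle
      ((Real.summable_one_div_nat_pow.2 one_lt_two).mul_left C)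
  have hfin : ∫⁻ ω, ∑' k, ENNReal.ofReal (F k ω) ∂P ≠ ⊤ := by
    rw [lintegral_tsum fun k => (hFint k).aemeasurable.ennreal_ofReal]
    have : ∀ k, ∫⁻ ω, ENNReal.ofReal (F k ω) ∂P = ENNReal.ofReal (∫ ω, F k ω ∂P) := fun k =>
      (ofReal_integral_eq_lintegral_ofReal (hFint k)
        (Eventually.of_forall fun ω => sq_nonneg _)).symm
    simp only [this]
    exact hsum.tsum_ofReal_ne_top
  have hae := ae_lt_top' (AEMeasurable.tsum
    fun k => (hFint k).aemeasurable.ennreal_ofReal) hfin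
  filter_upwards [hae] with ω hω
  have hsub : Tendsto (fun k : ℕ => T (k ^ 2) ω / (k ^ 2 : ℕ)) atTop (𝓝 0) := by
    have h1 := ENNReal.tendsto_atTop_zero_of_tsum_ne_top hω.ne
    have h2 := (ENNReal.tendsto_toReal ENNReal.zero_ne_top).comp h1
    have h3 : Tendsto (fun k => F k ω) atTop (𝓝 0) := by
      refine h2.congr fun k => ?_
      simp only [Function.comp]
      rw [ENNReal.toReal_ofReal (sq_nonneg _)]
    have h4 := h3.sqrt
    rw [Real.sqrt_zero] at h4
    simp only [hF, Real.sqrt_sq_eq_abs] at h4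
    exact (tendsto_zero_iff_abs_tendsto_zero _).2 h4
  -- Adding the drift `B` makes the sequence monotone.
  have hmono : Monotone fun n : ℕ => T n ω + B * n := by
    refine monotone_nat_of_le_succ fun n => ?_
    have := (abs_le.1 (hstep n ω)).1
    push_cast
    linarith
  have hmain := tendsto_div_of_monotone_of_exists_subseq_tendsto_div _ B hmono fun a ha => by
    refine ⟨fun k => k ^ 2, ?_, tendsto_pow_atTop two_ne_zero, ?_⟩
    · have h1 : Tendsto (fun k : ℕ => (1 + 1 / (k : ℝ)) ^ 2) atTop (𝓝 1) := by
        simpa using ((tendsto_one_div_atTop_nhds_zero_nat (𝕜 := ℝ)).const_add 1).pow 2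
      filter_upwards [h1.eventually (gt_mem_nhds ha), eventually_gt_atTop 0] with k hk hk0
      have hk' : (0 : ℝ) < k := by exact_mod_cast hk0
      have h2 : ((k : ℝ) + 1) ^ 2 = (1 + 1 / (k : ℝ)) ^ 2 * (k : ℝ) ^ 2 := by
        field_simp
      push_cast
      rw [h2]
      exact mul_le_mul_of_nonneg_right hk.le (by positivity)
    · have h1 := hsub.add_const B
      rw [zero_add] at h1
      refine h1.congr' ?_
      filter_upwards [eventually_gt_atTop 0] with k hk
      have hk' : ((k ^ 2 : ℕ) : ℝ) ≠ 0 := by positivity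
      rw [add_div, mul_div_cancel_right₀ _ hk']
  have h1 := hmain.sub_const B
  rw [sub_self] at h1
  refine h1.congr' ?_
  filter_upwards [eventually_gt_atTop 0] with n hn
  have hn' : (n : ℝ) ≠ 0 := by exact_mod_cast hn.ne'
  rw [add_div, mul_div_cancel_right₀ _ hn', add_sub_cancel_right]

/-! ### Innovations as martingale differences -/

/-- The step sequence whose steps `1, …, n` are the letters of the word `v`; the other steps,
which nothing depends on, are `1`. -/
def extendWord {Γ : Type*} [One Γ] {S : Finset Γ} {n : ℕ} (v : Finset.Icc 1 n → S) : ℕ → Γ :=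
  fun i => if h : i ∈ Finset.Icc 1 n then v ⟨i, h⟩ else 1

/-- A function of the first `n` steps is almost surely a finite combination of indicators of
cylinder events. -/
theorem ae_eq_sum_indicator_pastEvent {Ω Γ : Type*} [MeasurableSpace Ω] [One Γ] {P : Measure Ω}
    {S : Finset Γ} {g : ℕ → Ω → Γ} {n : ℕ} (hS : ∀ᵐ ω ∂P, ∀ i ∈ Finset.Icc 1 n, g i ω ∈ S)
    {ψ : (ℕ → Γ) → ℝ} (hψ : DependsOn ψ (Set.Icc 1 n)) :
    (fun ω => ψ fun i => g i ω) =ᵐ[P] fun ω => ∑ v : Finset.Icc 1 n → S,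
      (pastEvent g n (extendWord v)).indicator (fun _ => ψ (extendWord v)) ω := by
  filter_upwards [hS] with ω hω
  rw [Finset.sum_eq_single (fun i : Finset.Icc 1 n => (⟨g i ω, hω i i.2⟩ : S))]
  · have h : ∀ i ∈ Finset.Icc 1 n, g i ω =
        extendWord (fun i : Finset.Icc 1 n => (⟨g i ω, hω i i.2⟩ : S)) i := by
      intro i hi
      rw [extendWord, dif_pos hi]
    rw [Set.indicator_of_mem (s := pastEvent g n _) h]
    exact hψ fun i hi => h i (Finset.mem_Icc.2 hi)
  · intro v _ hv
    refine Set.indicator_of_notMem (fun hmem => hv ?_) _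
    funext i
    have := hmem i i.2
    rw [extendWord, dif_pos i.2] at this
    exact Subtype.ext this.symm
  · simp

section Innovations

variable {Ω Γ : Type*} [MeasurableSpace Ω] [MeasurableSpace Γ]

/-- Given the steps `g 1, …, g n`, the letter `a ∈ S` is the next step with a probability that is an
affine function of its frequency `x` so far, namely `1 / |S| + α * (x - 1 / |S|)`. That all steps
almost surely lie in `S` is a consequence. The value `g 0` is not used. -/
structure IsLinearlyReinforced (P : Measure Ω) (S : Finset Γ) (α : ℝ) (g : ℕ → Ω → Γ) : Prop where
  measurable_step : ∀ n, Measurable (g n)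
  step_law : ∀ n, ∀ s : ℕ → Γ, ∀ a ∈ S, P.real (pastEvent g n s ∩ {ω | g (n + 1) ω = a}) =
    stepProb S α a s n * P.real (pastEvent g n s)

theorem measurableSet_pastEvent [DiscreteMeasurableSpace Γ] {g : ℕ → Ω → Γ}
    (hg : ∀ n, Measurable (g n)) (n : ℕ) (s : ℕ → Γ) : MeasurableSet (pastEvent g n s) := by
  have : pastEvent g n s = ⋂ i ∈ Finset.Icc 1 n, g i ⁻¹' {s i} := by
    ext ω
    simp [pastEvent]
  rw [this]
  exact Finset.measurableSet_biInter _ fun i _ => hg i (MeasurableSet.of_discrete)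

variable [One Γ] [DiscreteMeasurableSpace Γ] {P : Measure Ω} [IsProbabilityMeasure P]
  {S : Finset Γ} {g : ℕ → Ω → Γ} {n : ℕ}

theorem integrable_of_dependsOn (hg : ∀ n, Measurable (g n))
    (hS : ∀ᵐ ω ∂P, ∀ i ∈ Finset.Icc 1 n, g i ω ∈ S)
    {ψ : (ℕ → Γ) → ℝ} (hψ : DependsOn ψ (Set.Icc 1 n)) :
    Integrable (fun ω => ψ fun i => g i ω) P := by
  refine (integrable_finsetSum _ fun v _ => ?_).congr (ae_eq_sum_indicator_pastEvent hS hψ).symm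
  exact (integrable_const _).indicator (measurableSet_pastEvent hg n _)

theorem setIntegral_of_dependsOn (hg : ∀ n, Measurable (g n))
    (hS : ∀ᵐ ω ∂P, ∀ i ∈ Finset.Icc 1 n, g i ω ∈ S)
    {ψ : (ℕ → Γ) → ℝ} (hψ : DependsOn ψ (Set.Icc 1 n)) (E : Set Ω) :
    ∫ ω in E, ψ (fun i => g i ω) ∂P = ∑ v : Finset.Icc 1 n → S,
      ψ (extendWord v) * P.real (pastEvent g n (extendWord v) ∩ E) := by
  rw [integral_congr_ae (ae_restrict_of_ae (ae_eq_sum_indicator_pastEvent hS hψ)),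
    integral_finsetSum]
  · refine Finset.sum_congr rfl fun v _ => ?_
    have hm := measurableSet_pastEvent hg n (extendWord v)
    rw [integral_indicator hm, setIntegral_const,
      measureReal_restrict_apply hm, smul_eq_mul, mul_comm]
  · intro v _
    exact (integrable_const _).indicator (measurableSet_pastEvent hg n _)

/-- The defining property of the conditional expectation of the indicator of `g (n + 1) = a` given
the past, tested against functions of the past. -/
theorem IsLinearlyReinforced.setIntegral_next_step {α : ℝ} (h : IsLinearlyReinforced P S α g)
    (hS : ∀ᵐ ω ∂P, ∀ i ∈ Finset.Icc 1 n, g i ω ∈ S)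
    {ψ : (ℕ → Γ) → ℝ} (hψ : DependsOn ψ (Set.Icc 1 n)) {a : Γ} (ha : a ∈ S) :
    ∫ ω in {ω | g (n + 1) ω = a}, ψ (fun i => g i ω) ∂P =
      ∫ ω, ψ (fun i => g i ω) * stepProb S α a (fun i => g i ω) n ∂P := by
  have hψ' : DependsOn (fun s => ψ s * stepProb S α a s n) (Set.Icc 1 n) := fun s t hst => by
    have h1 := dependsOn_stepProb S α a n hst
    dsimp only at h1 ⊢
    rw [hψ hst, h1]
  have h2 := setIntegral_of_dependsOn h.measurable_step hS hψ' Set.univ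
  rw [setIntegral_univ] at h2
  rw [h2, setIntegral_of_dependsOn h.measurable_step hS hψ]
  refine Finset.sum_congr rfl fun v _ => ?_
  rw [h.step_law n _ a ha, Set.inter_univ]
  ring

/-- The steps of a linearly reinforced sequence stay in `S`, as the conditional probabilities of
its letters add up to one. -/
theorem IsLinearlyReinforced.ae_mem {α : ℝ} (h : IsLinearlyReinforced P S α g) (hS : 0 < S.card) :
    ∀ n, ∀ᵐ ω ∂P, ∀ i ∈ Finset.Icc 1 n, g i ω ∈ S := by
  intro n
  induction n with
  | zero => simp
  | succ n ih =>
    have hmeas : ∀ a, MeasurableSet {ω | g (n + 1) ω = a} := fun a =>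
      h.measurable_step (n + 1) (MeasurableSet.of_discrete (s := {a}))
    have hstep : ∀ a ∈ S, P.real {ω | g (n + 1) ω = a} =
        ∫ ω, stepProb S α a (fun i => g i ω) n ∂P := by
      intro a ha
      have := h.setIntegral_next_step ih (ψ := fun _ => 1) (fun _ _ _ => rfl) ha
      simpa using this
    have hprob : P.real {ω | g (n + 1) ω ∈ S} = 1 := by
      have hU : {ω | g (n + 1) ω ∈ S} = ⋃ a ∈ S, {ω | g (n + 1) ω = a} := by
        ext ω
        simp
      rw [hU, measureReal_biUnion_finset (fun a _ b _ hab => ?_) fun a _ => hmeas a,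
        Finset.sum_congr rfl hstep, ← integral_finsetSum]
      · rw [integral_congr_ae (g := fun _ => (1 : ℝ))]
        · simp
        · filter_upwards [ih] with ω hω
          exact sum_stepProb hS α hω
      · exact fun a _ => integrable_of_dependsOn h.measurable_step ih (dependsOn_stepProb S α a n)
      · exact Set.disjoint_left.2 fun ω h1 h2 => hab (h1.symm.trans h2)
    have hnext : ∀ᵐ ω ∂P, g (n + 1) ω ∈ S := by
      have hm : MeasurableSet {ω | g (n + 1) ω ∈ S} :=
        h.measurable_step (n + 1) (MeasurableSet.of_discrete (s := (S : Set Γ)))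
      exact (prob_compl_eq_zero_iff hm).2 ((ENNReal.toReal_eq_one_iff _).1 hprob)
    filter_upwards [ih, hnext] with ω h1 h2 i hi
    rcases (Finset.mem_Icc.1 hi).2.lt_or_eq with hlt | rfl
    · exact h1 i (Finset.mem_Icc.2 ⟨(Finset.mem_Icc.1 hi).1, Nat.lt_succ_iff.1 hlt⟩)
    · exact h2

/-- Innovations are orthogonal to every function of the past. -/
theorem IsLinearlyReinforced.integral_mul_innovation {α : ℝ} (h : IsLinearlyReinforced P S α g)
    (hS : 0 < S.card) {ψ : (ℕ → Γ) → ℝ} (hψ : DependsOn ψ (Set.Icc 1 n)) {a : Γ} (ha : a ∈ S) :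
    ∫ ω, ψ (fun i => g i ω) * innovation S α a (fun i => g i ω) n ∂P = 0 := by
  classical
  have hmeas : MeasurableSet {ω | g (n + 1) ω = a} :=
    h.measurable_step (n + 1) (MeasurableSet.of_discrete (s := {a}))
  have hψ' : DependsOn (fun s => ψ s * stepProb S α a s n) (Set.Icc 1 n) := fun s t hst => by
    have h1 := dependsOn_stepProb S α a n hst
    dsimp only at h1 ⊢
    rw [hψ hst, h1]
  have heq : ∀ ω, ψ (fun i => g i ω) * innovation S α a (fun i => g i ω) n =
      {ω | g (n + 1) ω = a}.indicator (fun ω => ψ fun i => g i ω) ω -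
        ψ (fun i => g i ω) * stepProb S α a (fun i => g i ω) n := by
    intro ω
    by_cases hω : g (n + 1) ω = a <;> simp [innovation, Set.indicator, hω, mul_sub]
  simp only [heq]
  rw [integral_sub, integral_indicator hmeas, h.setIntegral_next_step (h.ae_mem hS n) hψ ha,
    sub_self]
  · exact (integrable_of_dependsOn h.measurable_step (h.ae_mem hS n) hψ).indicator hmeas
  · exact integrable_of_dependsOn h.measurable_step (h.ae_mem hS n) hψ'

/-- Strong law for innovations with bounded predictable weights: the weighted innovations are
orthogonal, so that the second moments of their sums grow linearly. -/
theorem IsLinearlyReinforced.ae_tendsto_sum_innovation_div {α : ℝ}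
    (h : IsLinearlyReinforced P S α g) (hS : 0 < S.card) (hα : |α| < 1) {c : ℕ → (ℕ → Γ) → ℝ}
    (hc : ∀ n, DependsOn (c n) (Set.Icc 1 n)) (hc1 : ∀ n s, |c n s| ≤ 1) {a : Γ} (ha : a ∈ S) :
    ∀ᵐ ω ∂P, Tendsto (fun n : ℕ => (∑ k ∈ Finset.range n,
      c k (fun i => g i ω) * innovation S α a (fun i => g i ω) k) / n) atTop (𝓝 0) := by
  set T : ℕ → (ℕ → Γ) → ℝ := fun n s => ∑ k ∈ Finset.range n, c k s * innovation S α a s k with hT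
  have hterm : ∀ n s, |c n s * innovation S α a s n| ≤ 3 := by
    intro n s
    rw [abs_mul]
    exact (mul_le_of_le_one_left (abs_nonneg _) (hc1 n s)).trans (abs_innovation_le hS hα s a n)
  have hTdep : ∀ n, DependsOn (T n) (Set.Icc 1 n) := by
    intro n s t hst
    refine Finset.sum_congr rfl fun k hk => ?_
    have hk := Finset.mem_range.1 hk
    have h1 := dependsOn_innovation S α a k fun i hi => hst i ⟨hi.1, hi.2.trans hk⟩
    dsimp only at h1
    rw [h1, hc k fun i hi => hst i ⟨hi.1, hi.2.trans hk.le⟩]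
  have hTsq : ∀ n, Integrable (fun ω => T n (fun i => g i ω) ^ 2) P := fun n =>
    integrable_of_dependsOn h.measurable_step (h.ae_mem hS n) (ψ := fun s => T n s ^ 2)
      fun s t hst => by
        dsimp only
        rw [hTdep n hst]
  have hsucc : ∀ n s, T (n + 1) s = T n s + c n s * innovation S α a s n := fun n s =>
    Finset.sum_range_succ _ _
  refine ae_tendsto_div_of_integral_sq_le (T := fun n ω => T n fun i => g i ω) (C := 9) (B := 3)
    hTsq (fun n ω => ?_) fun n => ?_
  · rw [hsucc, add_sub_cancel_left]
    exact hterm n _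
  · induction n with
    | zero => simp [hT]
    | succ n ih =>
      have hdep : DependsOn (fun s => 2 * (T n s * c n s)) (Set.Icc 1 n) := fun s t hst => by
        dsimp only
        rw [hTdep n hst, hc n hst]
      have hcross := h.integral_mul_innovation hS hdep ha
      have hdep' : DependsOn (fun s => 2 * (T n s * c n s) * innovation S α a s n)
          (Set.Icc 1 (n + 1)) := fun s t hst => by
        have h1 := dependsOn_innovation S α a n hst
        have h2 := hdep fun i hi => hst i ⟨hi.1, hi.2.trans n.le_succ⟩
        dsimp only at h1 h2 ⊢
        rw [h1, h2]
      have hcint := integrable_of_dependsOn h.measurable_step (h.ae_mem hS (n + 1)) hdep'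
      have hle : ∫ ω, T (n + 1) (fun i => g i ω) ^ 2 ∂P ≤
          ∫ ω, (T n (fun i => g i ω) ^ 2 + 2 * (T n (fun i => g i ω) * c n (fun i => g i ω)) *
            innovation S α a (fun i => g i ω) n + 9) ∂P := by
        refine integral_mono (hTsq _) (((hTsq n).add hcint).add (integrable_const 9)) fun ω => ?_
        have h1 := sq_le_sq' (abs_le.1 (hterm n fun i => g i ω)).1
          (abs_le.1 (hterm n fun i => g i ω)).2
        dsimp only
        rw [hsucc]
        linarith
      have hadd := integral_add ((hTsq n).add hcint) (integrable_const 9)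
      simp only [Pi.add_apply] at hadd
      rw [hadd, integral_add (hTsq n) hcint, hcross] at hle
      simp only [integral_const, probReal_univ, smul_eq_mul] at hle
      push_cast
      linarith

end Innovations

/-! ### The speed of reinforced walks -/

theorem IsLinearlyReinforced.ae_tendsto_walkDistance_div {Ω Γ : Type*} [Group Γ]
    [MeasurableSpace Γ] [DiscreteMeasurableSpace Γ] [MeasurableSpace Ω] {P : Measure Ω}
    [IsProbabilityMeasure P] {S : Finset Γ} {α : ℝ} {g : ℕ → Ω → Γ}
    (h : IsLinearlyReinforced P S α g) (hα : |α| < 1) (hd : 3 ≤ S.card)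
    (hsymm : ∀ s ∈ S, s⁻¹ ∈ S) (htree : IsRegularTree (leftCayleyGraph S) S.card) :
    ∀ᵐ ω ∂P, Tendsto (fun n : ℕ => (walkDistance S (fun i => g i ω) n : ℝ) / n) atTop
      (𝓝 (((S.card : ℝ) - 2) / S.card)) := by
  have hS : 0 < S.card := by omega
  have hpos : ∀ n, DependsOn (fun s : ℕ → Γ => walkPosition s n) (Set.Icc 1 n) := by
    intro n
    induction n with
    | zero => exact fun _ _ _ => rfl
    | succ n ih =>
      intro s t hst
      have h1 := ih fun i hi => hst i ⟨hi.1, hi.2.trans n.le_succ⟩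
      dsimp only at h1 ⊢
      rw [walkPosition, walkPosition, h1, hst (n + 1) ⟨Nat.le_add_left 1 n, le_rfl⟩]
  have hfreq : ∀ a ∈ S, ∀ᵐ ω ∂P, Tendsto (fun n : ℕ => (∑ k ∈ Finset.range n,
      innovation S α a (fun i => g i ω) k) / n) atTop (𝓝 0) := by
    intro a ha
    simpa using h.ae_tendsto_sum_innovation_div hS hα (c := fun _ _ => 1)
      (fun _ _ _ _ => rfl) (by simp) ha
  have hback : ∀ a ∈ S, ∀ᵐ ω ∂P, Tendsto (fun n : ℕ => (∑ k ∈ Finset.range n,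
      backward S (walkPosition (fun i => g i ω) k) a *
        innovation S α a (fun i => g i ω) k) / n) atTop (𝓝 0) := by
    intro a ha
    exact h.ae_tendsto_sum_innovation_div hS hα
      (c := fun k s => backward S (walkPosition s k) a)
      (fun n s t hst => congrArg (fun x => backward S x a) (hpos n hst))
      (fun _ _ => abs_backward_le_one _ _) ha
  filter_upwards [(ae_ball_iff S.countable_toSet).2 hfreq, (ae_ball_iff S.countable_toSet).2 hback,
    ae_all_iff.2 (h.ae_mem hS)] with ω h1 h2 h3
  exact tendsto_walkDistance_div hd hsymm htree hα
    (fun n => h3 (n + 1) (n + 1) (Finset.mem_Icc.2 ⟨Nat.le_add_left 1 n, le_rfl⟩)) h1 h2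

/-! ### The elephant and the simple random walk -/

theorem pastEvent_zero {Ω Γ : Type*} (g : ℕ → Ω → Γ) (s : ℕ → Γ) : pastEvent g 0 s = Set.univ := by
  simp [pastEvent]

/-- Averaging over the uniform epoch turns the frequency `x` of the letter `a` into the conditional
probability `p * x + q * (1 - x)` with `q = (1 - p) / (|S| - 1)`, which is reinforcement of
strength `p - q`. -/
theorem IsElephantRandomWalk.isLinearlyReinforced {Ω Γ : Type*} [MeasurableSpace Ω]
    [MeasurableSpace Γ] [DiscreteMeasurableSpace Γ] {P : Measure Ω} [IsProbabilityMeasure P]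
    {S : Finset Γ} (hd : 2 ≤ S.card) {p : ℝ} {D : ℕ → Ω → ℕ} {g : ℕ → Ω → Γ}
    (h : IsElephantRandomWalk P S p D g) :
    IsLinearlyReinforced P S (p - (1 - p) / ((S.card : ℝ) - 1)) g := by
  classical
  refine ⟨h.measurable_step, fun n s a ha => ?_⟩
  have hd' : (2 : ℝ) ≤ S.card := by exact_mod_cast hd
  rcases Nat.eq_zero_or_pos n with rfl | hn
  · simpa [pastEvent_zero, stepProb] using h.first_step a ha
  have hn' : (n : ℝ) ≠ 0 := by exact_mod_cast hn.ne'
  have hA := measurableSet_pastEvent h.measurable_step n s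
  have hD : ∀ k, MeasurableSet {ω | D n ω = k} := fun k =>
    h.measurable_epoch n (MeasurableSet.of_discrete (s := {k}))
  have hG : MeasurableSet {ω | g (n + 1) ω = a} :=
    h.measurable_step (n + 1) (MeasurableSet.of_discrete (s := {a}))
  have hdisj : Set.PairwiseDisjoint (Finset.Icc 1 n : Set ℕ)
      (fun k => pastEvent g n s ∩ {ω | D n ω = k}) := fun j _ k _ hjk =>
    Set.disjoint_left.2 fun ω h1 h2 => hjk (h1.2.symm.trans h2.2)
  -- Given the past, the epoch lies in `{1, …, n}` almost surely.
  have hcover : pastEvent g n s =ᵐ[P]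
      ⋃ k ∈ Finset.Icc 1 n, pastEvent g n s ∩ {ω | D n ω = k} := by
    refine (ae_eq_of_subset_of_measure_ge (Set.iUnion₂_subset fun k _ => Set.inter_subset_left)
      ?_ (Finset.measurableSet_biUnion _ fun k _ => hA.inter (hD k)).nullMeasurableSet
      (measure_ne_top _ _)).symm
    rw [← ENNReal.toReal_le_toReal (measure_ne_top _ _) (measure_ne_top _ _)]
    change P.real _ ≤ P.real _
    rw [measureReal_biUnion_finset hdisj fun k _ => hA.inter (hD k),
      Finset.sum_congr rfl fun k hk => h.epoch_uniform n hn s k hk]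
    simp [hn']
  rw [measureReal_congr (ae_eq_set_inter hcover (ae_eq_refl {ω | g (n + 1) ω = a})),
    Set.iUnion₂_inter,
    measureReal_biUnion_finset (fun j hj k hk hjk => (hdisj hj hk hjk).mono
      Set.inter_subset_left Set.inter_subset_left) fun k _ => (hA.inter (hD k)).inter hG]
  have hterm : ∀ k ∈ Finset.Icc 1 n,
      P.real (pastEvent g n s ∩ {ω | D n ω = k} ∩ {ω | g (n + 1) ω = a}) =
      1 / n * P.real (pastEvent g n s) * ((1 - p) / ((S.card : ℝ) - 1) +
        (p - (1 - p) / ((S.card : ℝ) - 1)) * (1 / S.card) +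
        (p - (1 - p) / ((S.card : ℝ) - 1)) * ((if s k = a then 1 else 0) - 1 / S.card)) := by
    intro k hk
    rw [h.next_step n hn s k hk a ha, h.epoch_uniform n hn s k hk]
    by_cases hka : a = s k
    · rw [if_pos hka, if_pos hka.symm]
      ring
    · rw [if_neg hka, if_neg (Ne.symm hka)]
      ring
  rw [Finset.sum_congr rfl hterm, ← Finset.mul_sum, Finset.sum_add_distrib, ← Finset.mul_sum]
  have hex : ∑ k ∈ Finset.Icc 1 n, ((if s k = a then (1 : ℝ) else 0) - 1 / S.card) =
      excess S s a n := rfl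
  have hq : (1 - p) / ((S.card : ℝ) - 1) + (p - (1 - p) / ((S.card : ℝ) - 1)) * (1 / S.card) =
      1 / S.card := by
    have h1 : (S.card : ℝ) - 1 ≠ 0 := by linarith
    have h2 : (S.card : ℝ) ≠ 0 := by linarith
    field_simp
    ring
  rw [hex, hq, stepProb]
  simp only [Finset.sum_const, Nat.card_Icc, Nat.add_sub_cancel, nsmul_eq_mul]
  field_simp

/-- The simple random walk is the case of no reinforcement. -/
theorem IsSimpleRandomWalk.isLinearlyReinforced {Ω Γ : Type*} [MeasurableSpace Ω]
    [MeasurableSpace Γ] [DiscreteMeasurableSpace Γ] {P : Measure Ω} {S : Finset Γ} {g : ℕ → Ω → Γ}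
    (h : IsSimpleRandomWalk P S g) :
    IsLinearlyReinforced P S 0 g := by
  refine ⟨h.measurable_step, fun n s a ha => ?_⟩
  have hpast : ∀ n (s : ℕ → Γ), P (pastEvent g n s) =
      ∏ i ∈ Finset.range n, P (g (i + 1) ⁻¹' {s (i + 1)}) := by
    intro n s
    rw [← h.independent.measure_inter_preimage_eq_mul _ fun i _ => MeasurableSet.of_discrete]
    congr 1
    ext ω
    simp only [pastEvent, Set.mem_ofPred_eq, Set.mem_iInter, Set.mem_preimage,
      Set.mem_singleton_iff, Finset.mem_Icc, Finset.mem_range]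
    refine ⟨fun H i hi => H (i + 1) ⟨by omega, by omega⟩, fun H i hi => ?_⟩
    have := H (i - 1) (by omega)
    rwa [Nat.sub_add_cancel hi.1] at this
  have hext : pastEvent g n s ∩ {ω | g (n + 1) ω = a} =
      pastEvent g (n + 1) (fun i => if i = n + 1 then a else s i) := by
    ext ω
    simp only [pastEvent, Set.mem_inter_iff, Set.mem_ofPred_eq, Finset.mem_Icc]
    refine ⟨fun H i hi => ?_, fun H => ⟨fun i hi => ?_, by simpa using H (n + 1) (by omega)⟩⟩
    · split_ifs with hin
      · exact hin ▸ H.2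
      · exact H.1 i ⟨hi.1, by omega⟩
    · have := H i ⟨hi.1, by omega⟩
      rwa [if_neg (by omega)] at this
  have hprod : P (pastEvent g n s ∩ {ω | g (n + 1) ω = a}) =
      P (pastEvent g n s) * P {ω | g (n + 1) ω = a} := by
    rw [hext, hpast, hpast, Finset.prod_range_succ, if_pos rfl]
    congr 1
    refine Finset.prod_congr rfl fun i hi => ?_
    rw [if_neg (by have := Finset.mem_range.1 hi; omega)]
  have hu := h.uniform n a ha
  rw [measureReal_def] at hu
  rw [measureReal_def, hprod, ENNReal.toReal_mul, hu, measureReal_def, stepProb]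
  ring

theorem theorem1 {Γ : Type*} [Group Γ] [MeasurableSpace Γ] [DiscreteMeasurableSpace Γ]
    (S : Finset Γ) (d : ℕ) (hd : 3 ≤ d) (hcard : S.card = d)
    (hsymm : ∀ s ∈ S, s⁻¹ ∈ S) (hgen : Subgroup.closure (S : Set Γ) = ⊤)
    (htree : IsRegularTree (leftCayleyGraph S) d)
    {Ω : Type*} [MeasurableSpace Ω] (P : Measure Ω) [IsProbabilityMeasure P] :
    (∀ p : ℝ, 0 ≤ p → p < 1 → ∀ (D : ℕ → Ω → ℕ) (g : ℕ → Ω → Γ),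
      IsElephantRandomWalk P S p D g →
        ∀ᵐ ω ∂P, Tendsto (fun n : ℕ => (walkDistance S (fun i => g i ω) n : ℝ) / (n : ℝ))
          atTop (𝓝 (((d : ℝ) - 2) / (d : ℝ)))) ∧
    (∀ g : ℕ → Ω → Γ, IsSimpleRandomWalk P S g →
      ∀ᵐ ω ∂P, Tendsto (fun n : ℕ => (walkDistance S (fun i => g i ω) n : ℝ) / (n : ℝ))
        atTop (𝓝 (((d : ℝ) - 2) / (d : ℝ)))) := by
  subst hcard
  refine ⟨fun p hp0 hp1 D g h => ?_, fun g h => ?_⟩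
  · refine (h.isLinearlyReinforced (by omega)).ae_tendsto_walkDistance_div ?_ hd hsymm htree
    have hd' : (3 : ℝ) ≤ S.card := by exact_mod_cast hd
    have hq0 : 0 ≤ (1 - p) / ((S.card : ℝ) - 1) := div_nonneg (by linarith) (by linarith)
    have hq1 : (1 - p) / ((S.card : ℝ) - 1) < 1 := by
      rw [div_lt_one (by linarith)]
      linarith
    rw [abs_lt]
    constructor <;> linarith
  · exact h.isLinearlyReinforced.ae_tendsto_walkDistance_div (by simp) hd hsymm htree
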